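/- Let $\mathbb H$ be the real algebra of quaternions and $\mathbb S=\{J\in\mathbb H: J^2=-1\}$. For $K=\{k_1<\dots<k_p\}\subseteq\{1,\dots,n\}$ and $J=(J_1,\dots,J_n)\in\mathbb S^n$ put $J_K=J_{k_1}\cdots J_{k_p}$, $J_\emptyset=1$. Let $\{e_K\}$, $K\subseteq\{1,\dots,n\}$, be a basis of $\mathbb R^{2^n}$, and for $h=1,\dots,n$ let $\mathcal J_h$ be the complex structure on $\mathbb H\otimes\mathbb R^{2^n}$ with $\mathcal J_h(e_Ka)=e_{K\cup\{h\}}a$ if $h\notin K$ and $\mathcal J_h(e_Ka)=-e_{K\setminus\{h\}}a$ if $h\in K$ ($a\in\mathbb H$). A stem function on $\mathbb C^n$ is a function $F=\sum_K e_KF_K:\mathbb C^n\to\mathbb H\otimes\mathbb R^{2^n}$ such that, for all $h$ and $K$, replacing $z_h$ by $\overline{z_h}$ changes $F_K(z)$ into $-F_K(z)$ if $h\in K$, and leaves it unchanged if $h\notin K$. A function $f:\mathbb H^n\to\mathbb H$ is called (left) slice-regular if there is a stem function $F$ of class $C^1$ on $\mathbb C^n$ such that $$f(\alpha_1+J_1\beta_1,\dots,\alpha_n+J_n\beta_n)=\sum_{K}J_K\,F_K(\alpha_1+i\beta_1,\dots,\alpha_n+i\beta_n)$$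 for all $\alpha,\beta\in\mathbb R^n$ and $J\in\mathbb S^n$, and $$\bar\partial_hF=\tfrac12\Big(\frac{\partial F}{\partial\alpha_h}+\mathcal J_h\Big(\frac{\partial F}{\partial\beta_h}\Big)\Big)=0\qquad\text{for } h=1,\dots,n.$$ **Corollary.** Let $d_1,\dots,d_n\ge 0$ be integers. Assume that the four real components of $f:\mathbb H^n\simeq\mathbb R^{4n}\to\mathbb H\simeq\mathbb R^4$ are polynomials in the $4n$ real coordinates which, for each $m=1,\dots,n$, are homogeneous of degree $d_m$ in the four real coordinates $x_{m_0},x_{m_1},x_{m_2},x_{m_3}$ of $x_m$ (the zero polynomial being homogeneous of every degree). Then $f$ is slice-regular if and only if there is a constant $a\in\mathbb H$ such that $$f(x_1,\dots,x_n)=x_1^{d_1}\cdots x_n^{d_n}\,a\qquad\text{for all }(x_1,\dots,x_n)\in\mathbb H^n .$$ -/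

import Mathlib

open scoped Quaternion

namespace SliceAnalysis

noncomputable section

/-- The space `ℍ ⊗ ℝ^(2^n)`: an element `∑_K e_K a_K` is given by its components `a_K ∈ ℍ`,
indexed by the subsets `K` of the set of indices of the variables. -/
abbrev StemSpace (n : ℕ) : Type := Finset (Fin n) → ℍ[ℝ]

/-- The complex structure `𝒥_h` of `ℍ ⊗ ℝ^(2^n)`, i.e. the linear map with
`e_K a ↦ e_{K ∪ {h}} a` if `h ∉ K`, and `e_K a ↦ -e_{K \ {h}} a` if `h ∈ K`,
written in components. -/
def complexStructure {n : ℕ} (h : Fin n) (v : StemSpace n) : StemSpace n :=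
  fun K => if h ∈ K then v (K.erase h) else -v (insert h K)

/-- `F : ℂⁿ → ℍ ⊗ ℝ^(2^n)` is a stem function: conjugating `z_h` changes the sign of exactly those
components `F_K` with `h ∈ K`. -/
def IsStem {n : ℕ} (F : (Fin n → ℂ) → StemSpace n) : Prop :=
  ∀ (z : Fin n → ℂ) (K : Finset (Fin n)) (h : Fin n),
    F (Function.update z h (starRingEnd ℂ (z h))) K = if h ∈ K then -F z K else F z K

/-- The product `J_K = J_{k_1} ⋯ J_{k_p}` for `K = {k_1 < ⋯ < k_p}` (and `J_∅ = 1`). -/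
def unitProd {n : ℕ} (J : Fin n → ℍ[ℝ]) (K : Finset (Fin n)) : ℍ[ℝ] :=
  (List.ofFn fun m => if m ∈ K then J m else 1).prod

/-- `f : ℍⁿ → ℍ` is the (left) slice function `ℐ(F)` induced by `F`:
`f (α_1 + J_1 β_1, …, α_n + J_n β_n) = ∑_K J_K F_K (α_1 + i β_1, …, α_n + i β_n)`
for all real `α`, `β` and all imaginary units `J_1, …, J_n`. -/
def IsInducedBy {n : ℕ} (f : (Fin n → ℍ[ℝ]) → ℍ[ℝ]) (F : (Fin n → ℂ) → StemSpace n) : Prop :=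
  ∀ (α β : Fin n → ℝ) (J : Fin n → ℍ[ℝ]), (∀ m, J m ^ 2 = -1) →
    f (fun m => (α m : ℍ[ℝ]) + J m * (β m : ℍ[ℝ])) =
      ∑ K : Finset (Fin n), unitProd J K * F (fun m => (⟨α m, β m⟩ : ℂ)) K

/-- The Cauchy-Riemann operator `∂̄_h F = ½ (∂F/∂α_h + 𝒥_h (∂F/∂β_h))`, where `z_h = α_h + i β_h`. -/
def dbar {n : ℕ} (h : Fin n) (F : (Fin n → ℂ) → StemSpace n) (z : Fin n → ℂ) : StemSpace n :=
  (1 / 2 : ℝ) • (fderiv ℝ F z (Pi.single h 1) +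
    complexStructure h (fderiv ℝ F z (Pi.single h Complex.I)))

/-- `f : ℍⁿ → ℍ` is (left) slice-regular on `ℍⁿ`: it is the slice function induced by a stem
function of class `C¹` on `ℂⁿ` which is holomorphic with respect to `𝒥_1, …, 𝒥_n`. -/
def IsSliceRegular {n : ℕ} (f : (Fin n → ℍ[ℝ]) → ℍ[ℝ]) : Prop :=
  ∃ F : (Fin n → ℂ) → StemSpace n,
    IsStem F ∧ IsInducedBy f F ∧ ContDiff ℝ 1 F ∧ ∀ h z, dbar h F z = 0

/-- The four real components of a quaternion. -/
def realComponent (i : Fin 4) (q : ℍ[ℝ]) : ℝ := ![q.re, q.imI, q.imJ, q.imK] i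

/-- `g : ℍⁿ → ℝ` is a polynomial in the `4n` real coordinates which, for each `m`, is homogeneous
of degree `d m` in the four real coordinates of the variable `x_m` (the zero polynomial is
homogeneous of every degree). -/
def IsMultihomogeneousPolynomial {n : ℕ} (d : Fin n → ℕ) (g : (Fin n → ℍ[ℝ]) → ℝ) : Prop :=
  ∃ p : MvPolynomial (Fin n × Fin 4) ℝ,
    (∀ m : Fin n, p.IsWeightedHomogeneous (fun v => if v.1 = m then 1 else 0) (d m)) ∧
    ∀ x : Fin n → ℍ[ℝ], g x = p.eval fun v => realComponent v.2 (x v.1)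

end

end SliceAnalysis

namespace SliceAnalysis

open Finset

/-! A slice-regular function is determined by its restriction to `ℝⁿ`. At real points only the
component `F_∅` of the stem survives, and by the one-variable identity principle, used one variable
at a time, `F_∅` on `ℝⁿ` determines a holomorphic stem function (`IsStem.eq_of_eq_on_real`).
Multihomogeneity forces `f α = (∏ α_m ^ d_m) • f 1` for real `α`, which are the real values of the
monomial with `a = f 1`. That monomial is slice-regular with the explicit stem `monomialStem`, so
the two stems, hence the two functions, agree. -/

/-! ### Products and powers in complex slices -/

/-- Noncommutative expansion of a product of binomials over a list without repetitions. -/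
theorem list_prod_add_eq_sum_powerset {ι R : Type*} [DecidableEq ι] [Semiring R] (a b : ι → R)
    (l : List ι) (hl : l.Nodup) :
    (l.map fun m => a m + b m).prod =
      ∑ K ∈ l.toFinset.powerset, (l.map fun m => if m ∈ K then b m else a m).prod := by
  induction l with
  | nil => simp
  | cons x l ih =>
    obtain ⟨hx, hl⟩ := List.nodup_cons.1 hl
    have hx' : x ∉ l.toFinset := by simpa using hx
    rw [List.toFinset_cons, sum_powerset_insert hx', List.map_cons, List.prod_cons, ih hl,
      add_mul, mul_sum, mul_sum]
    congr 1
    · refine sum_congr rfl fun K hK => ?_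
      have : x ∉ K := fun h => hx' (mem_powerset.1 hK h)
      simp [this]
    · refine sum_congr rfl fun K _ => ?_
      simp only [List.map_cons, List.prod_cons, mem_insert_self, if_true]
      congr 2
      refine List.map_congr_left fun m hm => ?_
      have : m ≠ x := fun h => hx (h ▸ hm)
      simp [this]

/-- Real factors can be pulled out of a product of quaternions. -/
theorem list_prod_mul_coe {ι : Type*} (u : ι → ℍ[ℝ]) (c : ι → ℝ) (l : List ι) :
    (l.map fun m => u m * (c m : ℍ[ℝ])).prod = (l.map u).prod * ((l.map c).prod : ℝ) := by
  induction l with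
  | nil => simp
  | cons x l ih =>
    simp only [List.map_cons, List.prod_cons, ih, Quaternion.coe_mul]
    rw [mul_assoc, mul_assoc, ← mul_assoc (c x : ℍ[ℝ]),
      (Quaternion.coe_commutes (c x) (l.map u).prod), mul_assoc]

theorem prod_coe_add_unit_mul {n : ℕ} (J : Fin n → ℍ[ℝ]) (c s : Fin n → ℝ) :
    (List.ofFn fun m => (c m : ℍ[ℝ]) + J m * (s m : ℍ[ℝ])).prod =
      ∑ K : Finset (Fin n), unitProd J K * ((∏ m, if m ∈ K then s m else c m : ℝ) : ℍ[ℝ]) := by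
  have huniv : (List.finRange n).toFinset.powerset = (univ : Finset (Finset (Fin n))) := by
    ext; simp
  rw [List.ofFn_eq_map, list_prod_add_eq_sum_powerset _ _ _ (List.nodup_finRange n), huniv]
  refine sum_congr rfl fun K _ => ?_
  rw [unitProd, List.ofFn_eq_map, ← List.prod_ofFn, List.ofFn_eq_map, ← list_prod_mul_coe]
  congr 2
  funext m
  split_ifs <;> simp

theorem coe_add_unit_mul_pow {J : ℍ[ℝ]} (hJ : J ^ 2 = -1) (z : ℂ) (k : ℕ) :
    ((z.re : ℍ[ℝ]) + J * (z.im : ℍ[ℝ])) ^ k = ((z ^ k).re : ℍ[ℝ]) + J * ((z ^ k).im : ℍ[ℝ]) := by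
  induction k with
  | zero => simp
  | succ k ih =>
    have h1 : ∀ r s : ℝ, (r : ℍ[ℝ]) * (J * (s : ℍ[ℝ])) = J * ((r * s : ℝ) : ℍ[ℝ]) := fun r s => by
      rw [← mul_assoc, Quaternion.coe_commutes, mul_assoc, Quaternion.coe_mul]
    have h2 : ∀ r s : ℝ, J * (r : ℍ[ℝ]) * (J * (s : ℍ[ℝ])) = -((r * s : ℝ) : ℍ[ℝ]) := fun r s => by
      rw [mul_assoc, h1, ← mul_assoc, ← pow_two, hJ, neg_one_mul]
    rw [pow_succ, ih, pow_succ, Complex.mul_re, Complex.mul_im, add_mul, mul_add, mul_add, h1, h2,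
      mul_assoc J, ← Quaternion.coe_mul, ← Quaternion.coe_mul, Quaternion.coe_sub,
      Quaternion.coe_add, mul_add]
    abel

/-- Every quaternion lies in a complex slice. -/
theorem exists_eq_coe_add_unit_mul (x : ℍ[ℝ]) :
    ∃ (α β : ℝ) (J : ℍ[ℝ]), J ^ 2 = -1 ∧ x = (α : ℍ[ℝ]) + J * (β : ℍ[ℝ]) := by
  have hsq : x.im * x.im = -((‖x.im‖ ^ 2 : ℝ) : ℍ[ℝ]) := by
    have h := Quaternion.self_mul_star x.im
    rw [Quaternion.star_im, Quaternion.normSq_eq_norm_mul_self] at h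
    rw [pow_two, ← h]
    simp
  by_cases h : x.im = 0
  · let J : ℍ[ℝ] := ⟨0, 1, 0, 0⟩
    have hJ : J ^ 2 = -1 := by rw [pow_two]; ext <;> simp <;> simp [J]
    refine ⟨x.re, 0, J, hJ, ?_⟩
    · conv_lhs => rw [← Quaternion.re_add_im x, h]
      simp
  · have hn : ‖x.im‖ ≠ 0 := norm_ne_zero_iff.2 h
    refine ⟨x.re, ‖x.im‖, x.im * ((‖x.im‖⁻¹ : ℝ) : ℍ[ℝ]), ?_, ?_⟩
    · rw [pow_two, mul_assoc, ← mul_assoc _ x.im, Quaternion.coe_commutes, mul_assoc x.im,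
        ← mul_assoc x.im x.im, hsq, ← Quaternion.coe_mul, neg_mul, ← Quaternion.coe_mul]
      have : ‖x.im‖ ^ 2 * (‖x.im‖⁻¹ * ‖x.im‖⁻¹) = 1 := by field_simp
      rw [this, Quaternion.coe_one]
    · rw [mul_assoc, ← Quaternion.coe_mul, inv_mul_cancel₀ hn, Quaternion.coe_one, mul_one,
        Quaternion.re_add_im]

/-! ### The stem function of a monomial -/

noncomputable section

/-- The stem function `F_K(z) = (∏_{m ∉ K} Re z_m^{d_m}) (∏_{m ∈ K} Im z_m^{d_m}) a`. -/
def monomialStem {n : ℕ} (d : Fin n → ℕ) (a : ℍ[ℝ]) (z : Fin n → ℂ) : StemSpace n :=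
  fun K => (∏ m, if m ∈ K then (z m ^ d m).im else (z m ^ d m).re) • a

end

/-- Isolates the only factor depending on `z_h`, for both the parity and the partial derivatives. -/
theorem monomialStem_update {n : ℕ} (d : Fin n → ℕ) (a : ℍ[ℝ]) (z : Fin n → ℂ) (h : Fin n) (w : ℂ)
    (K : Finset (Fin n)) :
    monomialStem d a (Function.update z h w) K =
      (if h ∈ K then (w ^ d h).im else (w ^ d h).re) •
        (∏ m ∈ {h}ᶜ, if m ∈ K then (z m ^ d m).im else (z m ^ d m).re) • a := by
  rw [monomialStem, Fintype.prod_eq_mul_prod_compl h, mul_smul, Function.update_self]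
  congr 2
  refine prod_congr rfl fun m hm => ?_
  rw [Function.update_of_ne (by simpa using hm)]

theorem isStem_monomialStem {n : ℕ} (d : Fin n → ℕ) (a : ℍ[ℝ]) : IsStem (monomialStem d a) := by
  intro z K h
  conv_rhs => rw [← Function.update_eq_self h z]
  simp only [monomialStem_update, ← map_pow, Complex.conj_re, Complex.conj_im]
  split_ifs <;> simp

theorem isInducedBy_monomialStem {n : ℕ} (d : Fin n → ℕ) (a : ℍ[ℝ]) :
    IsInducedBy (fun x => (List.ofFn fun m => x m ^ d m).prod * a) (monomialStem d a) := by
  intro α β J hJ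
  have h : ∀ m, ((α m : ℍ[ℝ]) + J m * (β m : ℍ[ℝ])) ^ d m = _ := fun m =>
    coe_add_unit_mul_pow (hJ m) ⟨α m, β m⟩ (d m)
  simp only [h, prod_coe_add_unit_mul, sum_mul]
  refine sum_congr rfl fun K _ => ?_
  rw [mul_assoc, Quaternion.coe_mul_eq_smul, monomialStem]

theorem contDiff_monomialStem {n : ℕ} (d : Fin n → ℕ) (a : ℍ[ℝ]) :
    ContDiff ℝ 1 (monomialStem d a) := by
  refine contDiff_pi.2 fun K => ?_
  suffices ContDiff ℝ 1 fun z : Fin n → ℂ =>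
      ∏ m, if m ∈ K then (z m ^ d m).im else (z m ^ d m).re from this.smul contDiff_const
  refine contDiff_prod fun m _ => ?_
  have hp : ContDiff ℝ 1 fun z : Fin n → ℂ => z m ^ d m := (contDiff_apply ℝ ℂ m).pow _
  split_ifs
  · exact Complex.imCLM.contDiff.comp hp
  · exact Complex.reCLM.contDiff.comp hp

theorem fderiv_monomialStem_single {n : ℕ} (d : Fin n → ℕ) (a : ℍ[ℝ]) (z : Fin n → ℂ) (h : Fin n)
    (w : ℂ) (K : Finset (Fin n)) :
    fderiv ℝ (monomialStem d a) z (Pi.single h w) K =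
      (if h ∈ K then (d h * z h ^ (d h - 1) * w).im else (d h * z h ^ (d h - 1) * w).re) •
        (∏ m ∈ {h}ᶜ, if m ∈ K then (z m ^ d m).im else (z m ^ d m).re) • a := by
  have hd : DifferentiableAt ℝ (monomialStem d a) z :=
    (contDiff_monomialStem d a).differentiable one_ne_zero z
  have h1 := (hasDerivAt_pi.1 (hd.hasFDerivAt.hasLineDerivAt (Pi.single h w))) K
  refine h1.unique ?_
  have hupd : ∀ t : ℝ, z + t • (Pi.single h w : Fin n → ℂ) =
      Function.update z h (z h + t * w) := fun t => by
    ext m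
    by_cases hm : m = h
    · subst hm; simp
    · simp [hm]
  simp only [hupd, monomialStem_update]
  have h2 : HasDerivAt (fun t : ℝ => (z h + t * w) ^ d h) (d h * z h ^ (d h - 1) * w) 0 := by
    have h3 : HasDerivAt (fun t : ℝ => z h + t * w) w 0 := by
      simpa using ((Complex.ofRealCLM.hasDerivAt (x := (0 : ℝ))).mul_const w).const_add (z h)
    have h4 := h3.fun_pow (d h)
    simp only [Complex.ofReal_zero, zero_mul, add_zero] at h4
    exact h4
  refine HasDerivAt.smul_const ?_ _
  split_ifs
  · exact Complex.imCLM.hasFDerivAt.comp_hasDerivAt (0 : ℝ) h2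
  · exact Complex.reCLM.hasFDerivAt.comp_hasDerivAt (0 : ℝ) h2

/-- The factors with index other than `h` do not see whether `h ∈ K`; what remains is Cauchy-Riemann
for `z_h ^ d_h`. -/
theorem dbar_monomialStem {n : ℕ} (d : Fin n → ℕ) (a : ℍ[ℝ]) (h : Fin n) (z : Fin n → ℂ) :
    dbar h (monomialStem d a) z = 0 := by
  have key : ∀ K K' : Finset (Fin n), (∀ m ≠ h, (m ∈ K ↔ m ∈ K')) →
      (∏ m ∈ {h}ᶜ, if m ∈ K then (z m ^ d m).im else (z m ^ d m).re) =
        ∏ m ∈ {h}ᶜ, if m ∈ K' then (z m ^ d m).im else (z m ^ d m).re := fun K K' hK =>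
    prod_congr rfl fun m hm => by simp only [hK m (by simpa using hm)]
  funext K
  simp only [dbar, Pi.smul_apply, Pi.add_apply, Pi.zero_apply, complexStructure,
    fderiv_monomialStem_single]
  split_ifs with hK h2 h2
  · simp at h2
  · rw [key (K.erase h) K fun m hm => by simp [hm], ← add_smul]
    simp
  · rw [key (insert h K) K fun m hm => by simp [hm], ← sub_eq_add_neg, ← sub_smul]
    simp
  · simp at h2

/-! ### Uniqueness of holomorphic stem functions -/

/-- `𝒥_h` only mixes `K` with `K ∪ {h}`, so the equation splits into Cauchy-Riemann systems for
these pairs. -/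
theorem dbar_eq_zero_iff {n : ℕ} {h : Fin n} {F : (Fin n → ℂ) → StemSpace n} {z : Fin n → ℂ} :
    dbar h F z = 0 ↔ ∀ K, h ∉ K →
      fderiv ℝ F z (Pi.single h 1) K = fderiv ℝ F z (Pi.single h Complex.I) (insert h K) ∧
      fderiv ℝ F z (Pi.single h 1) (insert h K) = -fderiv ℝ F z (Pi.single h Complex.I) K := by
  rw [dbar, smul_eq_zero_iff_right (by norm_num), funext_iff]
  simp only [Pi.add_apply, Pi.zero_apply, complexStructure]
  refine ⟨fun H K hK => ⟨?_, ?_⟩, fun H K => ?_⟩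
  · have := H K
    rw [if_neg hK] at this
    exact add_neg_eq_zero.1 this
  · have := H (insert h K)
    rw [if_pos (mem_insert_self h K), erase_insert hK] at this
    exact eq_neg_of_add_eq_zero_left this
  · split_ifs with hK
    · have := (H (K.erase h) (notMem_erase h K)).2
      rw [insert_erase hK] at this
      rw [this, neg_add_cancel]
    · rw [(H K hK).1, add_neg_cancel]

/-- A pair of components of a `𝒥_h`-holomorphic function forms, after applying a real functional,
an entire function of `z_h`. -/
theorem differentiable_slice {n : ℕ} {F : (Fin n → ℂ) → StemSpace n} (hF : Differentiable ℝ F)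
    {h : Fin n} (hd : ∀ z, dbar h F z = 0) (z : Fin n → ℂ) {K : Finset (Fin n)} (hK : h ∉ K)
    (l : ℍ[ℝ] →L[ℝ] ℝ) :
    Differentiable ℂ fun w : ℂ => (l (F (Function.update z h w) K) : ℂ) +
      Complex.I * l (F (Function.update z h w) (insert h K)) := by
  intro w
  have h0 : ∀ L, HasFDerivAt (fun w : ℂ => (l (F (Function.update z h w) L) : ℂ))
      (Complex.ofRealCLM.comp (l.comp ((ContinuousLinearMap.proj L).comp
        ((fderiv ℝ F (Function.update z h w)).comp
          (ContinuousLinearMap.pi (Pi.single h (ContinuousLinearMap.id ℝ ℂ))))))) w := fun L =>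
    Complex.ofRealCLM.hasFDerivAt.comp w (l.hasFDerivAt.comp w
      ((ContinuousLinearMap.proj (R := ℝ) (φ := fun _ : Finset (Fin n) => ℍ[ℝ]) L).hasFDerivAt.comp w
        ((hF _).hasFDerivAt.comp w (hasFDerivAt_update z w))))
  have h1 := (h0 K).fun_add ((h0 (insert h K)).const_mul Complex.I)
  have hs : ∀ v : ℂ, (fun i => (Pi.single h (ContinuousLinearMap.id ℝ ℂ) :
      Fin n → ℂ →L[ℝ] ℂ) i v) = Pi.single h v := fun v => by
    ext i
    by_cases hi : i = h
    · subst hi; simp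
    · simp [hi]
  rw [differentiableAt_complex_iff_differentiableAt_real]
  refine ⟨h1.differentiableAt, ?_⟩
  obtain ⟨e1, e2⟩ := dbar_eq_zero_iff.1 (hd (Function.update z h w)) K hK
  rw [h1.fderiv]
  simp only [add_apply, smul_apply,
    ContinuousLinearMap.comp_apply, ContinuousLinearMap.coe_pi', hs, ContinuousLinearMap.proj_apply,
    e1, e2, smul_eq_mul, Complex.ofRealCLM_apply, map_neg]
  linear_combination (l (fderiv ℝ F (Function.update z h w) (Pi.single h Complex.I) K) : ℂ) *
    Complex.I_mul_I

/-- Identity principle: an entire function is determined by its values on the real axis. -/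
theorem eq_of_eq_on_real {g₁ g₂ : ℂ → ℂ} (h₁ : Differentiable ℂ g₁) (h₂ : Differentiable ℂ g₂)
    (h : ∀ t : ℝ, g₁ t = g₂ t) : g₁ = g₂ := by
  refine AnalyticOnNhd.eq_of_frequently_eq (z₀ := 0) (fun z _ => h₁.analyticAt z)
    (fun z _ => h₂.analyticAt z) ?_
  have hf : ∃ᶠ t : ℝ in nhdsWithin 0 {0}ᶜ, g₁ t = g₂ t :=
    (Filter.Eventually.of_forall h).frequently
  have ht : Filter.Tendsto (fun t : ℝ => (t : ℂ)) (nhdsWithin 0 {0}ᶜ) (nhdsWithin 0 {0}ᶜ) :=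
    tendsto_nhdsWithin_of_tendsto_nhds_of_eventually_within _
      ((Complex.continuous_ofReal.tendsto' 0 0 (by simp)).mono_left nhdsWithin_le_nhds)
      (eventually_mem_nhdsWithin.mono fun t ht => by simpa using ht)
  exact ht.frequently hf

/-- Conjugating a real `z_h` does nothing, so `F_K = -F_K`. -/
theorem IsStem.eq_zero_of_im_eq_zero {n : ℕ} {F : (Fin n → ℂ) → StemSpace n} (hF : IsStem F)
    {z : Fin n → ℂ} {h : Fin n} (hz : (z h).im = 0) {K : Finset (Fin n)} (hK : h ∈ K) :
    F z K = 0 := by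
  have := hF z K h
  rw [Complex.conj_eq_iff_im.2 hz, Function.update_eq_self, if_pos hK] at this
  have h2 : (2 : ℝ) • F z K = 0 := by rw [two_smul]; nth_rewrite 1 [this]; exact neg_add_cancel _
  exact (smul_eq_zero_iff_right two_ne_zero).1 h2

/-- Holomorphic stem functions are determined by the values of the component `F_∅` on `ℝⁿ`. -/
theorem IsStem.eq_of_eq_on_real {n : ℕ} {F G : (Fin n → ℂ) → StemSpace n} (hF : IsStem F)
    (hG : IsStem G) (dF : Differentiable ℝ F) (dG : Differentiable ℝ G)
    (cF : ∀ h z, dbar h F z = 0) (cG : ∀ h z, dbar h G z = 0)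
    (H : ∀ α : Fin n → ℝ, F (fun m => α m) ∅ = G (fun m => α m) ∅) : F = G := by
  -- Induction on the set `S` of coordinates allowed to be non-real: to free `h`, compare entire
  -- functions of `z_h`, equal on the real axis by the induction hypothesis.
  suffices ∀ (S : Finset (Fin n)) (z : Fin n → ℂ), (∀ m ∉ S, (z m).im = 0) → F z = G z from
    funext fun z => this univ z fun m hm => absurd (mem_univ m) hm
  intro S
  induction S using Finset.induction_on with
  | empty =>
    intro z hz
    have hz' : z = fun m => ((z m).re : ℂ) := by
      ext m
      exact Complex.ext rfl (by simpa using hz m (notMem_empty m))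
    funext K
    obtain rfl | ⟨h, hK⟩ := K.eq_empty_or_nonempty
    · rw [hz']; exact H _
    · rw [hF.eq_zero_of_im_eq_zero (hz h (notMem_empty h)) hK,
        hG.eq_zero_of_im_eq_zero (hz h (notMem_empty h)) hK]
  | insert h S _ ih =>
    intro z hz
    have key : ∀ K, h ∉ K → ∀ l : ℍ[ℝ] →L[ℝ] ℝ,
        l (F z K) = l (G z K) ∧ l (F z (insert h K)) = l (G z (insert h K)) := fun K hK l => by
      have := SliceAnalysis.eq_of_eq_on_real (differentiable_slice dF (cF h) z hK l)
        (differentiable_slice dG (cG h) z hK l) fun t => by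
          rw [ih (Function.update z h t) fun m hm => ?_]
          by_cases hmh : m = h
          · subst hmh; simp
          · rw [Function.update_of_ne hmh]
            exact hz m (by simp [hmh, hm])
      have := congrFun this (z h)
      simp only [Function.update_eq_self] at this
      exact ⟨by simpa using congrArg Complex.re this, by simpa using congrArg Complex.im this⟩
    funext K
    refine (SeparatingDual.eq_iff_forall_dual_eq (R := ℝ)).2 fun l => ?_
    by_cases hK : h ∈ K
    · have := (key (K.erase h) (notMem_erase h K) l).2
      rwa [insert_erase hK] at this
    · exact (key K hK l).1

/-! ### Values at real points -/

theorem unitProd_empty {n : ℕ} (J : Fin n → ℍ[ℝ]) : unitProd J ∅ = 1 := by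
  simp [unitProd]

theorem IsInducedBy.apply_coe {n : ℕ} {f : (Fin n → ℍ[ℝ]) → ℍ[ℝ]} {F : (Fin n → ℂ) → StemSpace n}
    (hf : IsInducedBy f F) (hF : IsStem F) (α : Fin n → ℝ) :
    f (fun m => (α m : ℍ[ℝ])) = F (fun m => α m) ∅ := by
  -- Any imaginary unit will do, since `β = 0`.
  obtain ⟨_, _, J, hJ, -⟩ := exists_eq_coe_add_unit_mul 0
  have h := hf α 0 (fun _ => J) fun _ => hJ
  simp only [Pi.zero_apply, Quaternion.coe_zero, mul_zero, add_zero] at h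
  rw [h, sum_eq_single ∅, unitProd_empty, one_mul]
  · rfl
  · intro K _ hK
    obtain ⟨h, hK⟩ := nonempty_iff_ne_empty.2 hK
    rw [hF.eq_zero_of_im_eq_zero (h := h) rfl hK, mul_zero]
  · simp

theorem IsInducedBy.unique {n : ℕ} {f g : (Fin n → ℍ[ℝ]) → ℍ[ℝ]} {F : (Fin n → ℂ) → StemSpace n}
    (hf : IsInducedBy f F) (hg : IsInducedBy g F) : f = g := by
  funext x
  choose α β J hJ hx using fun m => exists_eq_coe_add_unit_mul (x m)
  rw [funext hx, hf α β J hJ, hg α β J hJ]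

theorem IsMultihomogeneousPolynomial.apply_coe {n : ℕ} {d : Fin n → ℕ}
    {g : (Fin n → ℍ[ℝ]) → ℝ} (hg : IsMultihomogeneousPolynomial d g) (α : Fin n → ℝ) :
    g (fun m => (α m : ℍ[ℝ])) = (∏ m, α m ^ d m) * g 1 := by
  obtain ⟨p, hp, hgp⟩ := hg
  have hc : ∀ v : Fin n × Fin 4, realComponent v.2 (α v.1 : ℍ[ℝ]) =
      α v.1 * realComponent v.2 1 := by
    rintro ⟨m, k⟩
    fin_cases k <;> simp [realComponent]
  rw [hgp, hgp, MvPolynomial.eval_eq', MvPolynomial.eval_eq', mul_sum]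
  refine sum_congr rfl fun s hs => ?_
  simp only [hc, mul_pow, prod_mul_distrib, Pi.one_apply]
  -- In each monomial of `p` the exponents of the four coordinates of `x_m` add up to `d m`.
  have hdeg : ∏ v : Fin n × Fin 4, α v.1 ^ s v = ∏ m, α m ^ d m := by
    rw [Fintype.prod_prod_type]
    refine prod_congr rfl fun m _ => ?_
    simp only [prod_pow_eq_pow_sum]
    rw [← hp m (MvPolynomial.mem_support_iff.1 hs), Finsupp.weight_apply,
      Finsupp.sum_fintype _ _ (by simp), Fintype.sum_prod_type, sum_eq_single m]
    · simp
    · intro m' _ hm'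
      simp [hm']
    · simp
  rw [hdeg]
  ring

theorem apply_coe_of_isMultihomogeneousPolynomial {n : ℕ} {d : Fin n → ℕ}
    {f : (Fin n → ℍ[ℝ]) → ℍ[ℝ]}
    (hf : ∀ i : Fin 4, IsMultihomogeneousPolynomial d fun x => realComponent i (f x))
    (α : Fin n → ℝ) : f (fun m => (α m : ℍ[ℝ])) = (∏ m, α m ^ d m) • f 1 := by
  have h := fun i => (hf i).apply_coe α
  ext
  · exact h 0
  · exact h 1
  · exact h 2
  · exact h 3

end SliceAnalysis

theorem mainTheorem11 (n : ℕ) (d : Fin n → ℕ) (f : (Fin n → ℍ[ℝ]) → ℍ[ℝ])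
    (hf : ∀ i : Fin 4, SliceAnalysis.IsMultihomogeneousPolynomial d
      (fun x => SliceAnalysis.realComponent i (f x))) :
    SliceAnalysis.IsSliceRegular f ↔
      ∃ a : ℍ[ℝ], ∀ x : Fin n → ℍ[ℝ], f x = (List.ofFn fun m => x m ^ d m).prod * a := by
  open SliceAnalysis in
  constructor
  · rintro ⟨F, hF, hfF, dF, cF⟩
    refine ⟨f 1, congrFun ?_⟩
    have hFG : F = monomialStem d (f 1) :=
      hF.eq_of_eq_on_real (isStem_monomialStem d _) (dF.differentiable one_ne_zero)
        ((contDiff_monomialStem d _).differentiable one_ne_zero) cF (dbar_monomialStem d _)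
        fun α => by
          rw [← hfF.apply_coe hF, apply_coe_of_isMultihomogeneousPolynomial hf]
          simp [monomialStem, ← Complex.ofReal_pow]
    subst hFG
    exact hfF.unique (isInducedBy_monomialStem d (f 1))
  · rintro ⟨a, ha⟩
    refine ⟨monomialStem d a, isStem_monomialStem d a, ?_, contDiff_monomialStem d a,
      dbar_monomialStem d a⟩
    rw [funext ha]
    exact isInducedBy_monomialStem d a
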